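/- **Conventions.** Let $\mathcal A$ be a finite alphabet, $\mathcal A^*$ the free monoid of finite words over $\mathcal A$, and $\mathbf u=(u_n)_{n\in\mathbb N}\in\mathcal A^{\mathbb N}$ an infinite word. Let $\mathcal L(\mathbf u)$ be its set of (finite) factors. A map $\varphi:\mathcal A^*\to\mathcal A^*$ is a *morphism* if $\varphi(vw)=\varphi(v)\varphi(w)$ for all $v,w$, and an *antimorphism* if $\varphi(vw)=\varphi(w)\varphi(v)$ for all $v,w$. Let $G$ be a finite group (under composition, with identity $\mathrm{Id}$) of morphisms and antimorphisms of $\mathcal A^*$ that contains at least one antimorphism. Put $[w]=\{\mu(w):\mu\in G\}$. The language $\mathcal L(\mathbf u)$ is *closed under $G$* if $\mu(w)\in\mathcal L(\mathbf u)$ for all $w\in\mathcal L(\mathbf u)$, $\mu\in G$. A word $w$ is a *$G$-palindrome* if $w=\Theta(w)$ for some antimorphism $\Theta\in G$. A factor $w$ is *special* if $aw\in\mathcal L(\mathbf u)$ for at least two letters $a$, or $wa\in\mathcal L(\mathbf u)$ for at least two letters $a$. When $\mathcal L(\mathbf u)$ is closed under $G$, the *undirected graph of symmetries* $\Gamma_n(\mathbf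 u)$ of order $n\ge 0$ is the following multigraph (loops and multiple edges allowed). Its vertices are the classes $[w]$ of special factors $w$ of length $n$. Its edges are the classes $[e]$, where $e\in\mathcal L(\mathbf u)$, $|e|\ge n+1$, the prefix and the suffix of $e$ of length $n$ are special, and $e$ has no other occurrence of a special factor of length $n$; the edge $[e]$ joins the classes of the prefix and of the suffix of $e$ of length $n$. For $N\in\mathbb N=\{0,1,2,\dots\}$, $\mathbf u$ has *Property $G$-tls$(N)$* if $\mathcal L(\mathbf u)$ is closed under $G$ and, for every $n\ge N$: whenever $[e]$ is a loop of $\Gamma_n(\mathbf u)$, $e$ is a $G$-palindrome; and the graph obtained from $\Gamma_n(\mathbf u)$ by removing all loops is a tree (the graph without vertices counts as a tree). The word $\mathbf u$ is *$G$-rich* if it has Property $G$-tls$(1)$, and *almost $G$-rich* if it has Property $G$-tls$(N)$ for some $N\in\mathbb N$. For $w\in\mathcal L(\mathbf u)$, a factor $v\in\mathcal L(\mathbf u)$ with $|v|>|w|$ is a *complete $G$-return word of $[w]$* if a prefix and a suffix of $v$ belong to $[w]$ and $v$ contains no other occurrence of an element of $[w]$. The word $\mathbf u$ has *Property $G$-crw$(N)$*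 if for every $w\in\mathcal L(\mathbf u)$ with $|w|\ge N$, every complete $G$-return word of $[w]$ is a $G$-palindrome. **Theorem.** Let $\mathcal L(\mathbf u)$ be closed under $G$. Then: 1. $\mathbf u$ is $G$-rich if and only if $\mathbf u$ has Property $G$-crw$(1)$, i.e. for every nonempty $w\in\mathcal L(\mathbf u)$ every complete $G$-return word of $[w]$ is a $G$-palindrome; 2. $\mathbf u$ is almost $G$-rich if and only if there is $N\in\mathbb N$ such that $\mathbf u$ has Property $G$-crw$(N)$; 3. for every $N\in\mathbb N$, $\mathbf u$ has Property $G$-tls$(N)$ if and only if it has Property $G$-crw$(N)$. -/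

import Mathlib

namespace GRichness

/-! ### Morphisms and antimorphisms of the free monoid; finite words are lists -/

/-- `φ` is a morphism of the free monoid of finite words over `α`. -/
def IsMorphism {α : Type*} (φ : List α → List α) : Prop :=
  ∀ v w : List α, φ (v ++ w) = φ v ++ φ w

/-- `φ` is an antimorphism of the free monoid of finite words over `α`. -/
def IsAntimorphism {α : Type*} (φ : List α → List α) : Prop :=
  ∀ v w : List α, φ (v ++ w) = φ w ++ φ v

/-- The group (under composition) of all bijective morphisms and antimorphisms of the monoid of
finite words over `α`, that is, the group of units of the monoid of all morphisms and
antimorphisms. A group of morphisms and antimorphisms is a subgroup of it. -/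
def AM (α : Type*) : Subgroup (Equiv.Perm (List α)) where
  carrier := {φ | IsMorphism φ ∨ IsAntimorphism φ}
  mul_mem' := by
    rintro a b (ha | ha) (hb | hb)
    · left; intro v w; simp [hb v w, ha (b v) (b w)]
    · right; intro v w; simp [hb v w, ha (b w) (b v)]
    · right; intro v w; simp [hb v w, ha (b v) (b w)]
    · left; intro v w; simp [hb v w, ha (b w) (b v)]
  one_mem' := Or.inl fun _ _ => rfl
  inv_mem' := by
    rintro a (ha | ha)
    · left; intro v w; apply a.injective; simp [ha (a.symm v) (a.symm w)]
    · right; intro v w; apply a.injective; simp [ha (a.symm w) (a.symm v)]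

/-- A subgroup `G` of `AM α` acts on finite words by `g • w = g(w)`, and `wordClass G w` is
`[w] = {μ(w) | μ ∈ G}`. -/
abbrev wordClass {α : Type*} (G : Subgroup (AM α)) (w : List α) : Set (List α) :=
  MulAction.orbit G w

/-! ### Factors of an infinite word -/

/-- The language of the infinite word `u`: the set of all its (finite, possibly empty) factors. -/
def language {α : Type*} (u : ℕ → α) : Set (List α) :=
  {w | ∃ i n : ℕ, w = (List.range n).map fun j => u (i + j)}

/-- The index `i` is an occurrence of the word `w` in the finite word `v`. -/
def OccursAt {α : Type*} (w v : List α) (i : ℕ) : Prop :=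
  ∃ s t : List α, v = s ++ w ++ t ∧ s.length = i

/-- The language of `u` is closed under `G`. -/
def ClosedUnder {α : Type*} (G : Subgroup (AM α)) (u : ℕ → α) : Prop :=
  ∀ w ∈ language u, ∀ μ ∈ G, μ.1 w ∈ language u

/-- The left extensions of `w` in `u`. -/
def leftExt {α : Type*} (u : ℕ → α) (w : List α) : Set α := {a | a :: w ∈ language u}

/-- The right extensions of `w` in `u`. -/
def rightExt {α : Type*} (u : ℕ → α) (w : List α) : Set α := {a | w ++ [a] ∈ language u}

/-- `w` is a special factor of `u`: it is left special or right special, i.e. it has at least two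
left extensions or at least two right extensions. -/
def IsSpecial {α : Type*} (u : ℕ → α) (w : List α) : Prop :=
  w ∈ language u ∧ ((leftExt u w).Nontrivial ∨ (rightExt u w).Nontrivial)

/-! ### Graphs of symmetries -/

/-- The vertices of the graphs of symmetries of order `n`: the classes of special factors of
length `n`. -/
def symVertices {α : Type*} (G : Subgroup (AM α)) (u : ℕ → α) (n : ℕ) : Set (Set (List α)) :=
  {x | ∃ w, IsSpecial u w ∧ w.length = n ∧ x = wordClass G w}

/-- `e` is an edge from the vertex `x` to the vertex `y` in the directed graph of symmetries of
order `n`: it is a factor of `u` of length at least `n + 1`, its prefix of length `n` belongs to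
`x`, its suffix of length `n` belongs to `y`, and the prefix and the suffix are the only
occurrences in `e` of special factors of length `n`. -/
structure IsDirectedEdge {α : Type*} (G : Subgroup (AM α)) (u : ℕ → α) (n : ℕ)
    (e : List α) (x y : Set (List α)) : Prop where
  left_mem : x ∈ symVertices G u n
  right_mem : y ∈ symVertices G u n
  mem_language : e ∈ language u
  lt_length : n < e.length
  prefix_mem : e.take n ∈ x
  suffix_mem : e.drop (e.length - n) ∈ y
  special_iff : ∀ i : ℕ, (∃ z, IsSpecial u z ∧ z.length = n ∧ OccursAt z e i) ↔
    i = 0 ∨ i + n = e.length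

theorem le_length_of_mem_AM {α : Type*} {φ : Equiv.Perm (List α)} (h : φ ∈ AM α) (w : List α) :
    w.length ≤ (φ w).length := by
  have hnil : φ [] = [] := by
    rcases h with h | h <;> simpa using h [] []
  have hpos : ∀ a : α, 1 ≤ (φ [a]).length := by
    intro a
    rw [Nat.one_le_iff_ne_zero, Ne, List.length_eq_zero_iff, ← hnil]
    intro h0
    simpa using φ.injective h0
  induction w with
  | nil => simp
  | cons a t ih =>
    have h1 := hpos a
    have h2 : (φ (a :: t)).length = (φ [a]).length + (φ t).length := by
      rcases h with h | h
      · rw [← List.singleton_append, h, List.length_append]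
      · rw [← List.singleton_append, h, List.length_append, Nat.add_comm]
    simp only [List.length_cons]
    omega

theorem length_of_mem_AM {α : Type*} {φ : Equiv.Perm (List α)} (h : φ ∈ AM α) (w : List α) :
    (φ w).length = w.length := by
  apply le_antisymm _ (le_length_of_mem_AM h w)
  simpa using le_length_of_mem_AM ((AM α).inv_mem h) (φ w)

/-- Equivalent directed edges have the same pair of end vertices. -/
theorem IsDirectedEdge.ends {α : Type*} {G : Subgroup (AM α)} {u : ℕ → α} {n : ℕ}
    {e e' : List α} {x y x' y' : Set (List α)} (h : IsDirectedEdge G u n e x y)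
    (h' : IsDirectedEdge G u n e' x' y') (hee : wordClass G e = wordClass G e') :
    (x = x' ∧ y = y') ∨ (x = y' ∧ y = x') := by
  have key : ∀ {X Y : Set (List α)} {p q : List α} (g : G), X ∈ symVertices G u n →
      Y ∈ symVertices G u n → p ∈ X → q ∈ Y → q = g • p → X = Y := by
    rintro X Y p q g ⟨w, -, -, rfl⟩ ⟨z, -, -, rfl⟩ hp hq rfl
    exact (MulAction.orbit_eq_iff.2 hp).symm.trans
      ((MulAction.orbit_eq_iff.2 (MulAction.mem_orbit p g)).symm.trans
        (MulAction.orbit_eq_iff.2 hq))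
  have hmem : e' ∈ wordClass G e := hee ▸ MulAction.mem_orbit_self e'
  obtain ⟨g, hg⟩ := hmem
  have hg' : e' = g • e := hg.symm
  have hlen : e'.length = e.length := by rw [hg']; exact length_of_mem_AM g.1.2 e
  have hlt := h.lt_length
  have l1 : (g • e.take n).length = n := by
    refine (length_of_mem_AM g.1.2 (e.take n)).trans ?_
    simp; omega
  have l2 : (g • e.drop (e.length - n)).length = n := by
    refine (length_of_mem_AM g.1.2 (e.drop (e.length - n))).trans ?_
    simp; omega
  have l3 : (g • e.drop n).length = e.length - n := by
    refine (length_of_mem_AM g.1.2 (e.drop n)).trans ?_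
    simp
  have l4 : (g • e.take (e.length - n)).length = e.length - n := by
    refine (length_of_mem_AM g.1.2 (e.take (e.length - n))).trans ?_
    simp
  rcases g.1.2 with hm | hm
  · have e1 : e' = g • e.take n ++ g • e.drop n := by
      rw [hg']
      conv_lhs => rw [← List.take_append_drop n e]
      exact hm _ _
    have e2 : e' = g • e.take (e.length - n) ++ g • e.drop (e.length - n) := by
      rw [hg']
      conv_lhs => rw [← List.take_append_drop (e.length - n) e]
      exact hm _ _
    refine Or.inl ⟨key g h.left_mem h'.left_mem h.prefix_mem h'.prefix_mem ?_,
      key g h.right_mem h'.right_mem h.suffix_mem h'.suffix_mem ?_⟩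
    · rw [e1]; exact List.take_left' l1
    · rw [hlen, e2]; exact List.drop_left' l4
  · have e1 : e' = g • e.drop n ++ g • e.take n := by
      rw [hg']
      conv_lhs => rw [← List.take_append_drop n e]
      exact hm _ _
    have e2 : e' = g • e.drop (e.length - n) ++ g • e.take (e.length - n) := by
      rw [hg']
      conv_lhs => rw [← List.take_append_drop (e.length - n) e]
      exact hm _ _
    refine Or.inr ⟨key g h.left_mem h'.right_mem h.prefix_mem h'.suffix_mem ?_,
      key g h.right_mem h'.left_mem h.suffix_mem h'.prefix_mem ?_⟩
    · rw [hlen, e1]; exact List.drop_left' l3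
    · rw [e2]; exact List.take_left' l2

/-- The undirected graph of symmetries of `u` of order `n`, a multigraph with loops allowed. Its
edges are the classes `[e]` of the edges `e` of the directed graph of symmetries; `[e]` joins the
start and the end of `e`. -/
def symGraph {α : Type*} (G : Subgroup (AM α)) (u : ℕ → α) (n : ℕ) :
    Graph (Set (List α)) (Set (List α)) where
  vertexSet := symVertices G u n
  IsLink E x y := ∃ e, E = wordClass G e ∧
    (IsDirectedEdge G u n e x y ∨ IsDirectedEdge G u n e y x)
  isLink_symm := fun _ _ => ⟨fun _ _ ⟨e, hE, h⟩ => ⟨e, hE, h.symm⟩⟩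
  eq_or_eq_of_isLink_of_isLink := by
    rintro E x y v w ⟨e, rfl, h⟩ ⟨e', hE, h'⟩
    rcases h with h | h <;> rcases h' with h' | h' <;>
      rcases h.ends h' hE with ⟨h1, h2⟩ | ⟨h1, h2⟩ <;> simp [h1, h2]
  left_mem_of_isLink := by
    rintro E x y ⟨e, -, h | h⟩
    · exact h.left_mem
    · exact h.right_mem

/-- The graph obtained from the multigraph `Γ` by removing all loops is a tree: it has no multiple
edges, any two of its vertices are connected, and it has no cycles. The graph without vertices
(which occurs as a graph of symmetries of a periodic word) counts as a tree. -/
def IsTreeWithoutLoops {V E : Type*} (Γ : Graph V E) : Prop :=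
  (Γ.deleteEdges {e | ∃ x, Γ.IsLoopAt e x}).Simple ∧
  (Γ.deleteEdges {e | ∃ x, Γ.IsLoopAt e x}).toSimpleGraph.Preconnected ∧
  (Γ.deleteEdges {e | ∃ x, Γ.IsLoopAt e x}).toSimpleGraph.IsAcyclic

/-! ### `G`-palindromes, `G`-richness and complete `G`-return words -/

/-- `w` is a `G`-palindrome: it is fixed by some antimorphism in `G`. -/
def IsGPalindrome {α : Type*} (G : Subgroup (AM α)) (w : List α) : Prop :=
  ∃ Θ ∈ G, IsAntimorphism Θ.1 ∧ w = Θ.1 w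

/-- Property `G`-tls(`N`). -/
def PropertyTls {α : Type*} (G : Subgroup (AM α)) (N : ℕ) (u : ℕ → α) : Prop :=
  ∀ n : ℕ, N ≤ n →
    ClosedUnder G u ∧
    (∀ (e : List α) (x : Set (List α)), (symGraph G u n).IsLoopAt (wordClass G e) x →
      IsGPalindrome G e) ∧
    IsTreeWithoutLoops (symGraph G u n)

/-- `u` is `G`-rich. -/
def IsGRich {α : Type*} (G : Subgroup (AM α)) (u : ℕ → α) : Prop :=
  PropertyTls G 1 u

/-- `u` is almost `G`-rich. -/
def IsAlmostGRich {α : Type*} (G : Subgroup (AM α)) (u : ℕ → α) : Prop :=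
  ∃ N : ℕ, PropertyTls G N u

/-- The index `i` is a `G`-occurrence of `w` in `v`. -/
def GOccursAt {α : Type*} (G : Subgroup (AM α)) (w v : List α) (i : ℕ) : Prop :=
  ∃ w' ∈ wordClass G w, OccursAt w' v i

/-- `v` is a complete `G`-return word of `[w]` in `u`: a factor of `u` longer than `w`, a prefix
and a suffix of which belong to `[w]`, and which contains no other `G`-occurrence of `w`. -/
structure IsCompleteGReturn {α : Type*} (G : Subgroup (AM α)) (u : ℕ → α) (w v : List α) :
    Prop where
  mem_language : v ∈ language u
  lt_length : w.length < v.length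
  prefix_mem : ∃ p ∈ wordClass G w, p <+: v
  suffix_mem : ∃ s ∈ wordClass G w, s <:+ v
  no_other : ∀ i : ℕ, GOccursAt G w v i → i = 0 ∨ i + w.length = v.length

/-- Property `G`-crw(`N`). -/
def PropertyCrw {α : Type*} (G : Subgroup (AM α)) (N : ℕ) (u : ℕ → α) : Prop :=
  ∀ w ∈ language u, N ≤ w.length → ∀ v, IsCompleteGReturn G u w v → IsGPalindrome G v

end GRichness

/-!
The three claims follow from the last one, the equivalence of Property `G`-tls(`N`) and Property
`G`-crw(`N`) for each `N`, which is `propertyTls_iff_propertyCrw`. Reading the special factors of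
length `n` along `u` is a walk on the graph of symmetries of order `n` in which every edge
occurs. A language closed under an antimorphism is recurrent (`ClosedUnder.exists_le_seg_eq`), so
the walk visits every vertex infinitely often, and antimorphisms in `G` reverse the walk. A complete
`G`-return word to a special factor is the part of the walk between two consecutive visits of a
vertex.

Suppose that the returns are palindromic. A loop is a complete `G`-return word, so it is a
`G`-palindrome. An excursion of the walk from a vertex `X` comes back through the edge through
which it left (`PalindromicReturns.entersBy_of_leaves`). Applying palindromicity to the returns to
another vertex `Z`, one sees that the edge through which the walk next enters `X` is the same after
all visits of `Z` (`PalindromicReturns.entersBy_unique`). So each edge at `X` cuts off its own set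
of vertices: there are no multiple edges, and each edge is a bridge. Connectedness is clear, as all
vertices lie on one walk.

Conversely, suppose that the graphs are trees with palindromic loops, and take a complete
`G`-return word `v` to `w` which is not a `G`-palindrome, with `d = |v| - |w|` minimal.
* If `w` is special, then `v` is not a loop, so it leaves the vertex `[w]` and comes back through
  the same edge in the opposite direction. Thus `v` begins with an edge `e` and ends with an
  antimorphic image of `e`; it is a complete `G`-return word to `e`, and minimality is violated.
* If `w` is not special and `v` ends with an antimorphic image of `w`, the same holds with
  the unique extension `wa` of `w` in place of `e`; if `v = wa`, then `v` is a `G`-palindrome.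
* If `w` is not special and `v` ends with a morphic image `μ(w)`, then `bwa`, the unique two-sided
  extension of `w`, again starts a counterexample with the same `d` (`BadReturn.extend`).
So only the last case occurs, and it repeats forever; hence `w` determines what follows it in `u`
(`BadReturn.seg_eq`). From some occurrence of `w` on, members of `[w]` therefore occur exactly at
every `d`-th position and are morphic images of `w`. As the antimorphic images of `w` also recur,
some antimorphism maps `w` to `μ(w)`, which has been excluded (`BadReturn.false`).
-/

namespace GRichness

variable {α : Type*}

/-! ### Windows of an infinite word -/

/-- The factor `u_i u_{i+1} ⋯ u_{i+m-1}` of length `m` of `u` read at position `i`. -/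
def seg (u : ℕ → α) (i m : ℕ) : List α := (List.range m).map fun j => u (i + j)

@[simp] theorem length_seg (u : ℕ → α) (i m : ℕ) : (seg u i m).length = m := by simp [seg]

theorem seg_mem_language (u : ℕ → α) (i m : ℕ) : seg u i m ∈ language u := ⟨i, m, rfl⟩

theorem exists_eq_seg {u : ℕ → α} {w : List α} (h : w ∈ language u) :
    ∃ i, w = seg u i w.length := by
  obtain ⟨i, n, rfl⟩ := h
  exact ⟨i, by simp [seg]⟩

theorem seg_add (u : ℕ → α) (i m k : ℕ) : seg u i (m + k) = seg u i m ++ seg u (i + m) k := by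
  simp [seg, List.range_add, Nat.add_assoc]

theorem seg_one (u : ℕ → α) (i : ℕ) : seg u i 1 = [u i] := by simp [seg]

theorem seg_succ (u : ℕ → α) (i m : ℕ) : seg u i (m + 1) = seg u i m ++ [u (i + m)] := by
  rw [seg_add, seg_one]

theorem seg_succ' (u : ℕ → α) (i m : ℕ) : seg u i (m + 1) = u i :: seg u (i + 1) m := by
  rw [Nat.add_comm, seg_add, seg_one]; rfl

theorem seg_eq_seg_of_add {u : ℕ → α} {i j c : ℕ} (h : seg u i c = seg u j c) {a m : ℕ}
    (ham : a + m ≤ c) : seg u (i + a) m = seg u (j + a) m := by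
  obtain ⟨b, rfl⟩ := Nat.exists_eq_add_of_le ham
  rw [seg_add, seg_add, seg_add, seg_add] at h
  have h1 := (List.append_inj h (by simp)).1
  exact (List.append_inj h1 (by simp)).2

theorem seg_eq_seg_of_le {u : ℕ → α} {i j c m : ℕ} (h : seg u i c = seg u j c) (hm : m ≤ c) :
    seg u i m = seg u j m :=
  seg_eq_seg_of_add (a := 0) h (by omega)

theorem occursAt_seg {u : ℕ → α} {w : List α} {i c k : ℕ} :
    OccursAt w (seg u i c) k ↔ k + w.length ≤ c ∧ w = seg u (i + k) w.length := by
  constructor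
  · rintro ⟨s, t, h, rfl⟩
    have hl : c = s.length + w.length + t.length := by
      simpa [Nat.add_assoc] using congrArg List.length h
    refine ⟨by omega, ?_⟩
    rw [hl, seg_add, seg_add] at h
    have h1 := (List.append_inj h (by simp)).1
    exact (List.append_inj h1 (by simp)).2.symm
  · rintro ⟨h, hw⟩
    obtain ⟨b, rfl⟩ := Nat.exists_eq_add_of_le h
    refine ⟨seg u i k, seg u (i + k + w.length) b, ?_, by simp⟩
    rw [seg_add, seg_add, ← hw, Nat.add_assoc]

/-! ### The action of `G` on windows -/

variable {G : Subgroup (AM α)}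

theorem length_smul (g : G) (w : List α) : (g • w).length = w.length := length_of_mem_AM g.1.2 w

/-- The class `[w]` of the window `w` of length `n` at position `i`. -/
def segClass (G : Subgroup (AM α)) (u : ℕ → α) (n i : ℕ) : Set (List α) :=
  wordClass G (seg u i n)

theorem wordClass_eq_iff {v w : List α} : wordClass G v = wordClass G w ↔ ∃ g : G, g • v = w := by
  rw [eq_comm, MulAction.orbit_eq_iff]
  exact Iff.rfl

theorem segClass_eq_iff {u : ℕ → α} {n i j : ℕ} :
    segClass G u n i = segClass G u n j ↔ ∃ g : G, g • seg u i n = seg u j n :=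
  wordClass_eq_iff

theorem length_of_mem_wordClass {v w : List α} (h : v ∈ wordClass G w) : v.length = w.length := by
  obtain ⟨g, rfl⟩ := h
  exact length_smul g w

theorem wordClass_eq_of_mem {v w : List α} (h : v ∈ wordClass G w) :
    wordClass G v = wordClass G w := MulAction.orbit_eq_iff.2 h

theorem smul_append_of_isMorphism {g : G} (hg : IsMorphism g.1.1) (v w : List α) :
    g • (v ++ w) = g • v ++ g • w := hg v w

theorem smul_append_of_isAntimorphism {g : G} (hg : IsAntimorphism g.1.1) (v w : List α) :
    g • (v ++ w) = g • w ++ g • v := hg v w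

theorem isMorphism_or_isAntimorphism (g : G) : IsMorphism g.1.1 ∨ IsAntimorphism g.1.1 := g.1.2

theorem IsMorphism.inv {g : G} (hg : IsMorphism g.1.1) : IsMorphism (g⁻¹ : G).1.1 := by
  intro v w
  change g⁻¹ • (v ++ w) = g⁻¹ • v ++ g⁻¹ • w
  rw [inv_smul_eq_iff, smul_append_of_isMorphism hg, smul_inv_smul, smul_inv_smul]

theorem IsAntimorphism.inv {g : G} (hg : IsAntimorphism g.1.1) : IsAntimorphism (g⁻¹ : G).1.1 := by
  intro v w
  change g⁻¹ • (v ++ w) = g⁻¹ • w ++ g⁻¹ • v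
  rw [inv_smul_eq_iff, smul_append_of_isAntimorphism hg, smul_inv_smul, smul_inv_smul]

theorem IsMorphism.mul {g h : G} (hg : IsMorphism g.1.1) (hh : IsMorphism h.1.1) :
    IsMorphism (g * h : G).1.1 := by
  intro v w
  change (g * h) • (v ++ w) = (g * h) • v ++ (g * h) • w
  rw [mul_smul, smul_append_of_isMorphism hh, smul_append_of_isMorphism hg, mul_smul, mul_smul]

theorem IsMorphism.mul_isAntimorphism {g h : G} (hg : IsMorphism g.1.1)
    (hh : IsAntimorphism h.1.1) : IsAntimorphism (g * h : G).1.1 := by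
  intro v w
  change (g * h) • (v ++ w) = (g * h) • w ++ (g * h) • v
  rw [mul_smul, smul_append_of_isAntimorphism hh, smul_append_of_isMorphism hg, mul_smul, mul_smul]

theorem IsAntimorphism.mul_isMorphism {g h : G} (hg : IsAntimorphism g.1.1)
    (hh : IsMorphism h.1.1) : IsAntimorphism (g * h : G).1.1 := by
  intro v w
  change (g * h) • (v ++ w) = (g * h) • w ++ (g * h) • v
  rw [mul_smul, smul_append_of_isMorphism hh, smul_append_of_isAntimorphism hg, mul_smul, mul_smul]

theorem IsAntimorphism.mul {g h : G} (hg : IsAntimorphism g.1.1) (hh : IsAntimorphism h.1.1) :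
    IsMorphism (g * h : G).1.1 := by
  intro v w
  change (g * h) • (v ++ w) = (g * h) • v ++ (g * h) • w
  rw [mul_smul, smul_append_of_isAntimorphism hh, smul_append_of_isAntimorphism hg, mul_smul,
    mul_smul]

theorem smul_seg_of_isMorphism {u : ℕ → α} {g : G} (hg : IsMorphism g.1.1) {i j c : ℕ}
    (h : g • seg u i c = seg u j c) {a m : ℕ} (ham : a + m ≤ c) :
    g • seg u (i + a) m = seg u (j + a) m := by
  obtain ⟨b, rfl⟩ := Nat.exists_eq_add_of_le ham
  rw [seg_add, seg_add, seg_add, seg_add, smul_append_of_isMorphism hg,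
    smul_append_of_isMorphism hg] at h
  have h1 := (List.append_inj h (by simp [length_smul])).1
  exact (List.append_inj h1 (by simp [length_smul])).2

theorem smul_seg_of_isAntimorphism {u : ℕ → α} {g : G} (hg : IsAntimorphism g.1.1) {i j c : ℕ}
    (h : g • seg u i c = seg u j c) {a m b : ℕ} (ham : a + m + b = c) :
    g • seg u (i + a) m = seg u (j + b) m := by
  have h2 : seg u j (a + m + b) = seg u j b ++ (seg u (j + b) m ++ seg u (j + (b + m)) a) := by
    rw [show a + m + b = b + (m + a) by omega, seg_add, seg_add, Nat.add_assoc]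
  rw [← ham, h2, seg_add, seg_add, smul_append_of_isAntimorphism hg,
    smul_append_of_isAntimorphism hg] at h
  have h1 := (List.append_inj h (by simp [length_smul])).2
  exact (List.append_inj h1 (by simp [length_smul])).1

/-- Reflection: if an antimorphism maps the word spanned by the windows of length `n` at the
positions `i, …, i + d` to the one spanned by `j, …, j + d`, it maps the part spanned by
`p, …, q` to the part spanned by the reflected positions, where `q'` is the reflection of `q`. -/
theorem smul_seg_reflect {u : ℕ → α} {g : G} (hg : IsAntimorphism g.1.1) {i j d n : ℕ}
    (h : g • seg u i (d + n) = seg u j (d + n)) {p q q' : ℕ} (hip : i ≤ p) (hpq : p ≤ q)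
    (hqd : q ≤ i + d) (hq' : q + q' = i + j + d) :
    g • seg u p (q - p + n) = seg u q' (q - p + n) := by
  have := smul_seg_of_isAntimorphism hg h (a := p - i) (m := q - p + n) (b := i + d - q) (by omega)
  rwa [show i + (p - i) = p by omega, show j + (i + d - q) = q' by omega] at this

theorem segClass_reflect {u : ℕ → α} {g : G} (hg : IsAntimorphism g.1.1) {i j d n : ℕ}
    (h : g • seg u i (d + n) = seg u j (d + n)) {p p' : ℕ} (hip : i ≤ p)
    (hpd : p ≤ i + d) (hp' : p + p' = i + j + d) :
    segClass G u n p' = segClass G u n p := by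
  have := smul_seg_reflect hg h hip le_rfl hpd hp'
  rw [Nat.sub_self, Nat.zero_add] at this
  exact (segClass_eq_iff.2 ⟨g, this⟩).symm

/-- The image of a `G`-palindrome is a `G`-palindrome: conjugate the antimorphism. -/
theorem IsGPalindrome.smul {w : List α} (h : IsGPalindrome G w) (g : G) :
    IsGPalindrome G (g • w) := by
  obtain ⟨Θ, hΘ, hanti, hw⟩ := h
  have hw' : (⟨Θ, hΘ⟩ : G) • w = w := hw.symm
  have hanti' : IsAntimorphism (⟨Θ, hΘ⟩ : G).1.1 := hanti
  refine ⟨(g * ⟨Θ, hΘ⟩ * g⁻¹ : G).1, (g * ⟨Θ, hΘ⟩ * g⁻¹ : G).2, ?_, ?_⟩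
  · rcases isMorphism_or_isAntimorphism g with hg | hg
    · exact (hg.mul_isAntimorphism hanti').mul_isMorphism hg.inv
    · exact (hg.mul hanti').mul_isAntimorphism hg.inv
  · change g • w = (g * ⟨Θ, hΘ⟩ * g⁻¹ : G) • (g • w)
    rw [mul_smul, inv_smul_smul, mul_smul, hw']

theorem isGPalindrome_iff {w : List α} :
    IsGPalindrome G w ↔ ∃ g : G, IsAntimorphism g.1.1 ∧ g • w = w :=
  ⟨fun ⟨Θ, hΘ, h, hw⟩ => ⟨⟨Θ, hΘ⟩, h, hw.symm⟩, fun ⟨g, h, hw⟩ => ⟨g.1, g.2, h, hw.symm⟩⟩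

/-! ### Recurrence and special factors -/

theorem ClosedUnder.smul_mem {u : ℕ → α} (hu : ClosedUnder G u) {w : List α}
    (hw : w ∈ language u) (g : G) : g • w ∈ language u := hu w hw g.1 g.2

theorem ClosedUnder.exists_smul_seg {u : ℕ → α} (hu : ClosedUnder G u) (g : G) (i m : ℕ) :
    ∃ j, g • seg u i m = seg u j m := by
  obtain ⟨j, hj⟩ := exists_eq_seg (hu.smul_mem (seg_mem_language u i m) g)
  exact ⟨j, by simpa [length_smul] using hj⟩

/-- A language closed under an antimorphism is recurrent: an antimorphism moves an occurrence close
to the beginning of a long prefix of `u` close to the end of its image. -/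
theorem ClosedUnder.exists_le_seg_eq {u : ℕ → α} (hu : ClosedUnder G u)
    (hG : ∃ Θ ∈ G, IsAntimorphism Θ.1) (i m M : ℕ) : ∃ j, M ≤ j ∧ seg u j m = seg u i m := by
  obtain ⟨Θ, hΘ, hanti⟩ := hG
  obtain ⟨g, hg⟩ : ∃ g : G, IsAntimorphism g.1.1 := ⟨⟨Θ, hΘ⟩, hanti⟩
  obtain ⟨a, ha⟩ := hu.exists_smul_seg g⁻¹ i m
  obtain ⟨j, hj⟩ := hu.exists_smul_seg g 0 (a + m + M)
  have h := smul_seg_of_isAntimorphism hg hj (a := a) (m := m) (b := M) rfl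
  rw [Nat.zero_add, ← ha, smul_inv_smul] at h
  exact ⟨j + M, by omega, h.symm⟩

theorem exists_smul_singleton (g : G) (a : α) : ∃ b, g • [a] = [b] :=
  List.length_eq_one_iff.1 (by rw [length_smul]; rfl)

theorem IsSpecial.smul {u : ℕ → α} (hu : ClosedUnder G u) {w : List α} (hw : IsSpecial u w)
    (g : G) : IsSpecial u (g • w) := by
  refine ⟨hu.smul_mem hw.1 g, ?_⟩
  have inj : ∀ {a b a' b' : α}, a ≠ b → g • [a] = [a'] → g • [b] = [b'] → a' ≠ b' := by
    rintro a b a' b' hab ha hb rfl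
    exact hab (by simpa using smul_left_cancel g (ha.trans hb.symm))
  rcases hw.2 with ⟨a, ha, b, hb, hab⟩ | ⟨a, ha, b, hb, hab⟩ <;>
    obtain ⟨a', ha'⟩ := exists_smul_singleton g a <;>
    obtain ⟨b', hb'⟩ := exists_smul_singleton g b <;>
    have h1 := hu.smul_mem ha g <;> have h2 := hu.smul_mem hb g <;>
    rcases isMorphism_or_isAntimorphism g with hg | hg
  · rw [← List.singleton_append, smul_append_of_isMorphism hg] at h1 h2
    exact Or.inl ⟨a', by simpa [leftExt, ha'] using h1, b', by simpa [leftExt, hb'] using h2,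
      inj hab ha' hb'⟩
  · rw [← List.singleton_append, smul_append_of_isAntimorphism hg] at h1 h2
    exact Or.inr ⟨a', by simpa [rightExt, ha'] using h1, b', by simpa [rightExt, hb'] using h2,
      inj hab ha' hb'⟩
  · rw [smul_append_of_isMorphism hg] at h1 h2
    exact Or.inr ⟨a', by simpa [rightExt, ha'] using h1, b', by simpa [rightExt, hb'] using h2,
      inj hab ha' hb'⟩
  · rw [smul_append_of_isAntimorphism hg] at h1 h2
    exact Or.inl ⟨a', by simpa [leftExt, ha'] using h1, b', by simpa [leftExt, hb'] using h2,
      inj hab ha' hb'⟩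

/-- The window of length `n` at position `i` is a special factor. -/
def SpecialAt (u : ℕ → α) (n i : ℕ) : Prop := IsSpecial u (seg u i n)

theorem SpecialAt.of_segClass_eq {u : ℕ → α} (hu : ClosedUnder G u) {n i j : ℕ}
    (h : SpecialAt u n i) (hij : segClass G u n i = segClass G u n j) : SpecialAt u n j := by
  obtain ⟨g, hg⟩ := segClass_eq_iff.1 hij
  have := IsSpecial.smul hu h g
  rwa [hg] at this

theorem seg_succ_eq_of_not_specialAt {u : ℕ → α} {n i j : ℕ} (h : ¬ SpecialAt u n i)
    (hij : seg u i n = seg u j n) : seg u i (n + 1) = seg u j (n + 1) := by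
  rw [seg_succ, seg_succ, ← hij]
  by_contra hne
  refine h ⟨seg_mem_language _ _ _, Or.inr ⟨u (i + n), ?_, u (j + n), ?_, fun he => hne (by rw [he])⟩⟩
  · simpa [rightExt, seg_succ] using seg_mem_language u i (n + 1)
  · simpa [rightExt, seg_succ, hij] using seg_mem_language u j (n + 1)

theorem seg_pred_eq_of_not_specialAt {u : ℕ → α} {n i j : ℕ} (h : ¬ SpecialAt u n (i + 1))
    (hij : seg u (i + 1) n = seg u (j + 1) n) : seg u i (n + 1) = seg u j (n + 1) := by
  rw [seg_succ', seg_succ', ← hij]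
  by_contra hne
  refine h ⟨seg_mem_language _ _ _, Or.inl ⟨u i, ?_, u j, ?_, fun he => hne (by rw [he])⟩⟩
  · simpa [leftExt, seg_succ'] using seg_mem_language u i (n + 1)
  · simpa [leftExt, seg_succ', hij] using seg_mem_language u j (n + 1)

variable {u : ℕ → α} {N n : ℕ}

/-! ### Complete `G`-return words and edges, read along the infinite word -/

/-- The windows of length `n` at the positions `i` and `i + d` are consecutive occurrences of
members of one class, so that the word they span is a complete `G`-return word. -/
structure ReturnAt (G : Subgroup (AM α)) (u : ℕ → α) (n i d : ℕ) : Prop where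
  pos : 0 < d
  eq : segClass G u n (i + d) = segClass G u n i
  ne : ∀ k, 0 < k → k < d → segClass G u n (i + k) ≠ segClass G u n i

theorem eq_seg_of_prefix {p : List α} {i c m : ℕ} (h : p <+: seg u i c) (hp : p.length = m) :
    p = seg u i m := by
  obtain ⟨t, ht⟩ := h
  have hc : c = m + t.length := by simpa [hp] using (congrArg List.length ht).symm
  rw [hc, seg_add] at ht
  exact (List.append_inj ht (by simp [hp])).1

theorem eq_seg_of_suffix {s : List α} {i c d m : ℕ} (h : s <:+ seg u i c) (hs : s.length = m)
    (hc : d + m = c) : s = seg u (i + d) m := by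
  obtain ⟨t, ht⟩ := h
  rw [← hc, seg_add] at ht
  exact (List.append_inj' ht (by simp [hs])).2

theorem ReturnAt.isCompleteGReturn {i d : ℕ} (h : ReturnAt G u n i d) :
    IsCompleteGReturn G u (seg u i n) (seg u i (d + n)) where
  mem_language := seg_mem_language _ _ _
  lt_length := by have := h.pos; simp; omega
  prefix_mem := ⟨seg u i n, MulAction.mem_orbit_self _, by
    rw [Nat.add_comm, seg_add]; exact List.prefix_append _ _⟩
  suffix_mem := ⟨seg u (i + d) n, by
    rw [← MulAction.orbit_eq_iff]; exact h.eq, by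
    rw [seg_add]; exact List.suffix_append _ _⟩
  no_other := by
    rintro k ⟨w, hw, ho⟩
    have hl : w.length = n := by simpa using length_of_mem_wordClass hw
    rw [occursAt_seg, hl] at ho
    obtain ⟨hk, rfl⟩ := ho
    by_contra! hne
    simp only [length_seg] at hne
    exact h.ne k (by omega) (by omega) (wordClass_eq_of_mem hw)

theorem IsCompleteGReturn.exists_returnAt {w v : List α} (h : IsCompleteGReturn G u w v) :
    ∃ i d, v = seg u i (d + w.length) ∧ ReturnAt G u w.length i d := by
  obtain ⟨i, hv⟩ := exists_eq_seg h.mem_language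
  have hlt := h.lt_length
  obtain ⟨d, hd⟩ := Nat.exists_eq_add_of_le' hlt.le
  rw [hd] at hv
  have hcl : segClass G u w.length i = wordClass G w := by
    obtain ⟨p, hp, hpv⟩ := h.prefix_mem
    rw [hv] at hpv
    rw [eq_seg_of_prefix hpv (length_of_mem_wordClass hp)] at hp
    exact wordClass_eq_of_mem hp
  refine ⟨i, d, hv, by omega, ?_, fun k hk hkd he => ?_⟩
  · obtain ⟨s, hs, hsv⟩ := h.suffix_mem
    rw [hv] at hsv
    rw [eq_seg_of_suffix hsv (length_of_mem_wordClass hs) rfl] at hs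
    rw [hcl]
    exact wordClass_eq_of_mem hs
  · have hmem : seg u (i + k) w.length ∈ wordClass G w := by
      rw [← MulAction.orbit_eq_iff]; exact he.trans hcl
    have := h.no_other k ⟨_, hmem, by
      rw [hv, occursAt_seg]; simp; omega⟩
    omega

theorem propertyCrw_iff : PropertyCrw G N u ↔
    ∀ n, N ≤ n → ∀ i d, ReturnAt G u n i d → IsGPalindrome G (seg u i (d + n)) := by
  constructor
  · intro h n hn i d hr
    exact h _ (seg_mem_language u i n) (by simpa using hn) _ hr.isCompleteGReturn
  · intro h w _ hw v hv
    obtain ⟨i, d, rfl, hr⟩ := hv.exists_returnAt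
    exact h _ hw i d hr

/-- The positions `r < q` are consecutive occurrences of special factors of length `n`, so that the
word spanned by the windows at `r` and `q` is an edge of the graph of symmetries. -/
structure EdgeAt (u : ℕ → α) (n r q : ℕ) : Prop where
  lt : r < q
  left : SpecialAt u n r
  right : SpecialAt u n q
  not_special : ∀ k, r < k → k < q → ¬ SpecialAt u n k

/-- The class of the word spanned by the windows of length `n` at the positions `r` and `q`. -/
def spanClass (G : Subgroup (AM α)) (u : ℕ → α) (n r q : ℕ) : Set (List α) :=
  wordClass G (seg u r (q - r + n))

theorem SpecialAt.mem_symVertices {i : ℕ} (h : SpecialAt u n i) :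
    segClass G u n i ∈ symVertices G u n := ⟨_, h, by simp, rfl⟩

theorem exists_of_mem_symVertices {x : Set (List α)} (h : x ∈ symVertices G u n) :
    ∃ i, SpecialAt u n i ∧ x = segClass G u n i := by
  obtain ⟨w, hw, rfl, rfl⟩ := h
  obtain ⟨i, hi⟩ := exists_eq_seg hw.1
  refine ⟨i, ?_, ?_⟩
  · rw [SpecialAt, ← hi]; exact hw
  · rw [segClass, ← hi]

theorem segClass_eq_of_mem {x : Set (List α)} (h : x ∈ symVertices G u n) {i : ℕ}
    (hi : seg u i n ∈ x) : x = segClass G u n i := by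
  obtain ⟨w, -, -, rfl⟩ := h
  exact (wordClass_eq_of_mem hi).symm

theorem EdgeAt.isDirectedEdge {r q : ℕ} (h : EdgeAt u n r q) :
    IsDirectedEdge G u n (seg u r (q - r + n)) (segClass G u n r) (segClass G u n q) where
  left_mem := h.left.mem_symVertices
  right_mem := h.right.mem_symVertices
  mem_language := seg_mem_language _ _ _
  lt_length := by have := h.lt; simp; omega
  prefix_mem := by
    rw [eq_seg_of_prefix (List.take_prefix n (seg u r (q - r + n))) (m := n) (by simp)]
    exact MulAction.mem_orbit_self _
  suffix_mem := by
    have := h.lt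
    rw [eq_seg_of_suffix (List.drop_suffix _ (seg u r (q - r + n))) (m := n) (d := q - r)
      (by simp) rfl, show r + (q - r) = q by omega]
    exact MulAction.mem_orbit_self _
  special_iff := by
    intro k
    have hlt := h.lt
    constructor
    · rintro ⟨z, hz, hzl, ho⟩
      rw [occursAt_seg, hzl] at ho
      obtain ⟨hk, rfl⟩ := ho
      by_contra! hne
      simp only [length_seg] at hne
      exact h.not_special (r + k) (by omega) (by omega) hz
    · rintro (rfl | hk)
      · exact ⟨_, h.left, by simp, by rw [occursAt_seg]; simp⟩
      · have hk' : r + k = q := by simp at hk; omega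
        refine ⟨_, h.right, by simp, ?_⟩
        rw [occursAt_seg]; simp [hk']; omega

theorem IsDirectedEdge.exists_edgeAt {e : List α} {x y : Set (List α)}
    (h : IsDirectedEdge G u n e x y) : ∃ r q, EdgeAt u n r q ∧ e = seg u r (q - r + n) ∧
      x = segClass G u n r ∧ y = segClass G u n q := by
  obtain ⟨r, he⟩ := exists_eq_seg h.mem_language
  have hlt := h.lt_length
  obtain ⟨d, hd⟩ := Nat.exists_eq_add_of_le' hlt.le
  rw [hd] at he
  have hp := h.prefix_mem
  have hs := h.suffix_mem
  have hp' : e.take n <+: seg u r (d + n) := he ▸ List.take_prefix n e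
  have hs' : e.drop (e.length - n) <:+ seg u r (d + n) := he ▸ List.drop_suffix _ e
  rw [eq_seg_of_prefix hp' (m := n) (by simp; omega)] at hp
  rw [eq_seg_of_suffix hs' (m := n) (d := d) (by simp; omega) rfl] at hs
  have key : ∀ k, k ≤ d → (SpecialAt u n (r + k) ↔ k = 0 ∨ k = d) := by
    intro k hk
    have := h.special_iff k
    rw [show (k + n = e.length ↔ k = d) by omega] at this
    rw [← this, he]
    constructor
    · intro hk'
      exact ⟨_, hk', by simp, by rw [occursAt_seg]; simp; omega⟩
    · rintro ⟨z, hz, hzl, ho⟩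
      rw [occursAt_seg, hzl] at ho
      rw [SpecialAt, ← ho.2]; exact hz
  refine ⟨r, r + d, ⟨by omega, (key 0 (by omega)).2 (by simp), (key d le_rfl).2 (by simp), ?_⟩,
    ?_, segClass_eq_of_mem h.left_mem hp, segClass_eq_of_mem h.right_mem hs⟩
  · intro k hk hkd hsp
    obtain ⟨a, rfl⟩ := Nat.exists_eq_add_of_le hk.le
    have := (key a (by omega)).1 hsp
    omega
  · rwa [Nat.add_sub_cancel_left]

theorem EdgeAt.reflect (hu : ClosedUnder G u) {g : G} (hg : IsAntimorphism g.1.1) {i j d : ℕ}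
    (h : g • seg u i (d + n) = seg u j (d + n)) {r q r' q' : ℕ} (he : EdgeAt u n r q)
    (hir : i ≤ r) (hqd : q ≤ i + d) (hr' : r + r' = i + j + d) (hq' : q + q' = i + j + d) :
    EdgeAt u n q' r' ∧ spanClass G u n q' r' = spanClass G u n r q := by
  have hlt := he.lt
  refine ⟨⟨by omega, ?_, ?_, ?_⟩, ?_⟩
  · exact he.right.of_segClass_eq hu (segClass_reflect hg h (by omega) hqd hq').symm
  · exact he.left.of_segClass_eq hu (segClass_reflect hg h hir (by omega) hr').symm
  · intro k hk hkr hsp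
    refine he.not_special (i + j + d - k) (by omega) (by omega) (hsp.of_segClass_eq hu ?_)
    exact segClass_reflect hg h (p := i + j + d - k) (by omega) (by omega) (by omega)
  · have := smul_seg_reflect hg h hir hlt.le hqd hq'
    rw [spanClass, show r' - q' = q - r by omega, ← this]
    exact wordClass_eq_of_mem (MulAction.mem_orbit _ g)

/-- Links of the undirected graph of symmetries are read along `u` in both directions, as an
antimorphism reverses edges. -/
theorem isLink_symGraph_iff (hu : ClosedUnder G u) (hG : ∃ Θ ∈ G, IsAntimorphism Θ.1)
    {E x y : Set (List α)} : (symGraph G u n).IsLink E x y ↔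
    ∃ r q, EdgeAt u n r q ∧ E = spanClass G u n r q ∧ x = segClass G u n r ∧
      y = segClass G u n q := by
  constructor
  · rintro ⟨e, rfl, h | h⟩
    · obtain ⟨r, q, h1, rfl, h2⟩ := h.exists_edgeAt
      exact ⟨r, q, h1, rfl, h2⟩
    · obtain ⟨r, q, h1, rfl, rfl, rfl⟩ := h.exists_edgeAt
      obtain ⟨Θ, hΘ, hanti⟩ := hG
      obtain ⟨g, hg⟩ : ∃ g : G, IsAntimorphism g.1.1 := ⟨⟨Θ, hΘ⟩, hanti⟩
      obtain ⟨j, hj⟩ := hu.exists_smul_seg g r (q - r + n)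
      have hlt := h1.lt
      obtain ⟨h2, h3⟩ := h1.reflect hu hg hj (r' := j + (q - r)) (q' := j) le_rfl (by omega)
        (by omega) (by omega)
      exact ⟨j, j + (q - r), h2, h3.symm,
        (segClass_reflect hg hj (by omega) (by omega) (by omega)).symm,
        (segClass_reflect hg hj (by omega) (by omega) (by omega)).symm⟩
  · rintro ⟨r, q, h, rfl, rfl, rfl⟩
    exact ⟨_, rfl, Or.inl h.isDirectedEdge⟩

/-- The graph of symmetries of order `n` without its loops. -/
abbrev looplessGraph (G : Subgroup (AM α)) (u : ℕ → α) (n : ℕ) :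
    Graph (Set (List α)) (Set (List α)) :=
  (symGraph G u n).deleteEdges {e | ∃ x, (symGraph G u n).IsLoopAt e x}

theorem isLink_looplessGraph_iff {E x y : Set (List α)} :
    (looplessGraph G u n).IsLink E x y ↔ (symGraph G u n).IsLink E x y ∧ x ≠ y := by
  rw [Graph.deleteEdges_isLink]
  refine and_congr_right fun h => ⟨?_, ?_⟩
  · rintro h' rfl
    exact h' ⟨x, h⟩
  · rintro hne ⟨z, hz⟩
    rcases hz.eq_and_eq_or_eq_and_eq h with h | h
    · exact hne (h.1.symm.trans h.2)
    · exact hne (h.2.symm.trans h.1)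

/-! ### Chains of consecutive special factors -/

theorem SpecialAt.exists_edgeAt_right {i j : ℕ} (hi : SpecialAt u n i) (hj : SpecialAt u n j)
    (hij : i < j) : ∃ s, s ≤ j ∧ EdgeAt u n i s := by
  classical
  have hex : ∃ s, i < s ∧ SpecialAt u n s := ⟨j, hij, hj⟩
  refine ⟨Nat.find hex, Nat.find_min' hex ⟨hij, hj⟩, (Nat.find_spec hex).1, hi,
    (Nat.find_spec hex).2, fun k hik hk hsp => ?_⟩
  exact Nat.find_min hex hk ⟨hik, hsp⟩

theorem SpecialAt.exists_edgeAt_left {i j : ℕ} (hi : SpecialAt u n i) (hj : SpecialAt u n j)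
    (hij : i < j) : ∃ s, i ≤ s ∧ EdgeAt u n s j := by
  classical
  have hex : ∃ b, 0 < b ∧ b ≤ j ∧ SpecialAt u n (j - b) :=
    ⟨j - i, by omega, by omega, by rwa [Nat.sub_sub_self hij.le]⟩
  obtain ⟨h1, h2, h3⟩ := Nat.find_spec hex
  have h4 : Nat.find hex ≤ j - i :=
    Nat.find_min' hex ⟨by omega, by omega, by rwa [Nat.sub_sub_self hij.le]⟩
  refine ⟨j - Nat.find hex, by omega, by omega, h3, hj, fun k hk hkj hsp => ?_⟩
  exact Nat.find_min hex (m := j - k) (by omega)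
    ⟨by omega, by omega, by rwa [Nat.sub_sub_self hkj.le]⟩

open Graph in
theorem SpecialAt.mem_vertexSet {i : ℕ} (h : SpecialAt u n i) :
    segClass G u n i ∈ V(looplessGraph G u n) := h.mem_symVertices

open Graph in
/-- The infinite word walks along the graph of symmetries: if the simple graph `H` contains all
non-loop edges read between the positions `i` and `j`, it connects the two vertices. -/
theorem reachable_of_forall_edgeAt {H : SimpleGraph V(looplessGraph G u n)} {i j : ℕ}
    (hij : i ≤ j) (hi : SpecialAt u n i) (hj : SpecialAt u n j)
    (hH : ∀ r q, i ≤ r → q ≤ j → EdgeAt u n r q → ∀ v w : V(looplessGraph G u n),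
      v.1 = segClass G u n r → w.1 = segClass G u n q → v ≠ w → H.Adj v w)
    {v w : V(looplessGraph G u n)} (hv : v.1 = segClass G u n i) (hw : w.1 = segClass G u n j) :
    H.Reachable v w := by
  induction hm : j - i using Nat.strong_induction_on generalizing i v with
  | _ m ih =>
    rcases hij.eq_or_lt with rfl | hlt
    · rw [Subtype.ext (hv.trans hw.symm)]
    · obtain ⟨s, hsj, hs⟩ := hi.exists_edgeAt_right hj hlt
      have his := hs.lt
      have hrest := ih (j - s) (by omega) hsj hs.right
        (fun r q hr hq => hH r q (by omega) hq) (v := ⟨_, hs.right.mem_vertexSet⟩) rfl rfl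
      by_cases hvs : v = ⟨_, hs.right.mem_vertexSet⟩
      · rwa [hvs]
      · exact (hH i s le_rfl hsj hs v _ hv rfl hvs).reachable.trans hrest

/-! ### Entry edges -/

/-- Read from position `t` on, `u` enters the vertex `X` for the first time through the
edge `E`, which begins at `t` or later. -/
def EntersBy (G : Subgroup (AM α)) (u : ℕ → α) (n : ℕ) (X : Set (List α)) (t : ℕ)
    (E : Set (List α)) : Prop :=
  ∃ r q, t ≤ r ∧ EdgeAt u n r q ∧ segClass G u n q = X ∧
    (∀ k, t ≤ k → k < q → segClass G u n k ≠ X) ∧ E = spanClass G u n r q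

theorem EntersBy.unique {X : Set (List α)} {t : ℕ} {E E' : Set (List α)}
    (h : EntersBy G u n X t E) (h' : EntersBy G u n X t E') : E = E' := by
  obtain ⟨r, q, htr, he, hX, hne, rfl⟩ := h
  obtain ⟨r', q', htr', he', hX', hne', rfl⟩ := h'
  have h1 := he.lt
  have h2 := he'.lt
  have hq : q = q' := by
    rcases lt_trichotomy q q' with h | h | h
    · exact absurd hX (hne' q (by omega) h)
    · exact h
    · exact absurd hX' (hne q' (by omega) h)
  subst hq
  have hr : r = r' := by
    rcases lt_trichotomy r r' with h | h | h
    · exact absurd he'.left (he.not_special r' h h2)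
    · exact h
    · exact absurd he.left (he'.not_special r h h1)
  rw [hr]

theorem EntersBy.of_le {X : Set (List α)} {s t : ℕ} {E : Set (List α)}
    (h : EntersBy G u n X t E) (hst : s ≤ t)
    (hne : ∀ k, s ≤ k → k < t → segClass G u n k ≠ X) : EntersBy G u n X s E := by
  obtain ⟨r, q, htr, he, hX, hne', rfl⟩ := h
  refine ⟨r, q, by omega, he, hX, fun k hk hkq => ?_, rfl⟩
  rcases lt_or_ge k t with h | h
  · exact hne k hk h
  · exact hne' k h hkq

theorem EntersBy.of_ge {X : Set (List α)} {s t : ℕ} {E : Set (List α)}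
    (h : EntersBy G u n X s E) (hst : s ≤ t) (ht : SpecialAt u n t)
    (hne : ∀ k, s ≤ k → k ≤ t → segClass G u n k ≠ X) : EntersBy G u n X t E := by
  obtain ⟨r, q, htr, he, hX, hne', rfl⟩ := h
  have hrq := he.lt
  have htq : t < q := by
    by_contra hcon
    exact hne q (by omega) (by omega) hX
  refine ⟨r, q, ?_, he, hX, fun k hk hkq => hne' k (by omega) hkq, rfl⟩
  by_contra hcon
  exact he.not_special t (by omega) htq ht

theorem exists_first_segClass_eq {X : Set (List α)} {t : ℕ}
    (hX : ∃ q, t ≤ q ∧ segClass G u n q = X) : ∃ q, t ≤ q ∧ segClass G u n q = X ∧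
      ∀ k, t ≤ k → k < q → segClass G u n k ≠ X := by
  classical
  refine ⟨Nat.find hX, (Nat.find_spec hX).1, (Nat.find_spec hX).2, fun k hk hkq h => ?_⟩
  exact Nat.find_min hX hkq ⟨hk, h⟩

theorem exists_le_segClass_eq (hu : ClosedUnder G u) (hG : ∃ Θ ∈ G, IsAntimorphism Θ.1)
    (i n M : ℕ) : ∃ j, M ≤ j ∧ segClass G u n j = segClass G u n i := by
  obtain ⟨j, hj, h⟩ := hu.exists_le_seg_eq hG i n M
  exact ⟨j, hj, by rw [segClass, h, segClass]⟩

theorem exists_entersBy (hu : ClosedUnder G u) (hG : ∃ Θ ∈ G, IsAntimorphism Θ.1)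
    {X : Set (List α)} (hX : X ∈ symVertices G u n) {t : ℕ} (ht : SpecialAt u n t)
    (htX : segClass G u n t ≠ X) : ∃ E, EntersBy G u n X t E := by
  obtain ⟨i, hi, rfl⟩ := exists_of_mem_symVertices hX
  obtain ⟨q, htq, hq, hne⟩ := exists_first_segClass_eq (exists_le_segClass_eq hu hG i n t)
  have hlt : t < q := htq.lt_of_ne (by rintro rfl; exact htX hq)
  obtain ⟨r, hr, he⟩ := ht.exists_edgeAt_left (hi.of_segClass_eq hu hq.symm) hlt
  exact ⟨_, r, q, hr, he, hq, hne, rfl⟩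

/-- All complete `G`-return words to factors of length `n` are `G`-palindromes. -/
def PalindromicReturns (G : Subgroup (AM α)) (u : ℕ → α) (n : ℕ) : Prop :=
  ∀ i d, ReturnAt G u n i d → IsGPalindrome G (seg u i (d + n))

/-- If all returns are palindromic, an excursion from `X` that starts with the edge `E` comes back
to `X` through `E`. -/
theorem PalindromicReturns.entersBy_of_leaves (hP : PalindromicReturns G u n)
    (hu : ClosedUnder G u) (hG : ∃ Θ ∈ G, IsAntimorphism Θ.1) {p s : ℕ} (he : EdgeAt u n p s)
    (hne : segClass G u n s ≠ segClass G u n p) :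
    EntersBy G u n (segClass G u n p) s (spanClass G u n p s) := by
  obtain ⟨q, hsq, hq, hfirst⟩ := exists_first_segClass_eq (exists_le_segClass_eq hu hG p n s)
  have hps := he.lt
  have hlt : s < q := hsq.lt_of_ne (by rintro rfl; exact hne hq)
  have hret : ReturnAt G u n p (q - p) := by
    refine ⟨by omega, by rwa [show p + (q - p) = q by omega], fun k hk hkd h => ?_⟩
    rcases lt_or_ge (p + k) s with h' | h'
    · exact he.not_special (p + k) (by omega) h' (he.left.of_segClass_eq hu h.symm)
    · exact hfirst (p + k) h' (by omega) h
  obtain ⟨g, hg, hpal⟩ := isGPalindrome_iff.1 (hP _ _ hret)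
  obtain ⟨h1, h2⟩ := he.reflect hu hg hpal (r' := q) (q' := p + q - s) le_rfl (by omega)
    (by omega) (by omega)
  refine ⟨p + q - s, q, ?_, h1, hq, hfirst, h2.symm⟩
  by_contra hcon
  exact he.not_special (p + q - s) (by omega) (by omega) h1.left

/-- Between two consecutive visits of a vertex `Z ≠ X` the entry edge into `X` is preserved: if `X`
is visited in between, the palindromic return word to `Z` leaves `X` for the last time through the
edge through which it has entered `X` for the first time. -/
theorem PalindromicReturns.entersBy_of_returnAt (hP : PalindromicReturns G u n)
    (hu : ClosedUnder G u) (hG : ∃ Θ ∈ G, IsAntimorphism Θ.1) {X E : Set (List α)} {t d : ℕ}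
    (ht : SpecialAt u n t) (hret : ReturnAt G u n t d) (hE : EntersBy G u n X t E) :
    EntersBy G u n X (t + d) E := by
  have ht' : SpecialAt u n (t + d) := ht.of_segClass_eq hu hret.eq.symm
  have hE' := hE
  obtain ⟨r, q, htr, he, hX, hne, rfl⟩ := hE
  have hrq := he.lt
  have hd := hret.pos
  have htX := hne t le_rfl (by omega)
  have ht'X : segClass G u n (t + d) ≠ X := by rw [hret.eq]; exact htX
  rcases lt_or_ge (t + d) q with hlt | hge
  · exact hE'.of_ge (by omega) ht' fun k hk hkt => hne k hk (by omega)
  have hq : q < t + d := hge.lt_of_ne (by rintro rfl; exact ht'X hX)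
  obtain ⟨g, hg, hpal⟩ := isGPalindrome_iff.1 (hP _ _ hret)
  obtain ⟨h1, h2⟩ := he.reflect hu hg hpal (r' := t + t + d - r) (q' := t + t + d - q) htr
    (by omega) (by omega) (by omega)
  have hX' : segClass G u n (t + t + d - q) = X := by
    rw [segClass_reflect hg hpal (p := q) (by omega) (by omega) (by omega), hX]
  have hne' : ∀ k, t + t + d - q < k → k ≤ t + d → segClass G u n k ≠ X := by
    intro k hk hkt h
    refine hne (t + t + d - k) (by omega) (by omega) ?_
    rw [segClass_reflect hg hpal (p := k) (by omega) (by omega) (by omega), h]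
  have h3 := hP.entersBy_of_leaves hu hG h1 (by
    rw [hX']; exact hne' _ (by omega) (by omega))
  rw [hX', h2] at h3
  exact h3.of_ge (by omega) ht' fun k hk hkt => hne' k (by omega) hkt

theorem PalindromicReturns.entersBy_of_lt (hP : PalindromicReturns G u n)
    (hu : ClosedUnder G u) (hG : ∃ Θ ∈ G, IsAntimorphism Θ.1) {X E : Set (List α)} {t t' : ℕ}
    (ht : SpecialAt u n t) (htt : t < t') (heq : segClass G u n t' = segClass G u n t)
    (hE : EntersBy G u n X t E) : EntersBy G u n X t' E := by
  induction hm : t' - t using Nat.strong_induction_on generalizing t with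
  | _ m ih =>
    obtain ⟨s, hs, hst, hne⟩ := exists_first_segClass_eq (t := t + 1) ⟨t', htt, heq⟩
    have hret : ReturnAt G u n t (s - t) :=
      ⟨by omega, by rwa [show t + (s - t) = s by omega],
        fun k hk hkd => hne (t + k) (by omega) (by omega)⟩
    have h1 := hP.entersBy_of_returnAt hu hG ht hret hE
    rw [show t + (s - t) = s by omega] at h1
    rcases lt_trichotomy s t' with h | rfl | h
    · exact ih (t' - s) (by omega) (ht.of_segClass_eq hu hst.symm) h (heq.trans hst.symm) h1 rfl
    · exact h1
    · exact absurd heq (hne t' (by omega) h)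

/-- The entry edge into `X` depends only on the vertex read at the starting position. -/
theorem PalindromicReturns.entersBy_unique (hP : PalindromicReturns G u n)
    (hu : ClosedUnder G u) (hG : ∃ Θ ∈ G, IsAntimorphism Θ.1) {X E E' : Set (List α)} {t t' : ℕ}
    (ht : SpecialAt u n t) (heq : segClass G u n t' = segClass G u n t)
    (hE : EntersBy G u n X t E) (hE' : EntersBy G u n X t' E') : E = E' := by
  rcases lt_trichotomy t t' with h | rfl | h
  · exact (hP.entersBy_of_lt hu hG ht h heq hE).unique hE'
  · exact hE.unique hE'
  · exact hE.unique (hP.entersBy_of_lt hu hG (ht.of_segClass_eq hu heq.symm) h heq.symm hE')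

theorem EdgeAt.entersBy (hu : ClosedUnder G u) {r q : ℕ} (he : EdgeAt u n r q)
    (hne : segClass G u n r ≠ segClass G u n q) :
    EntersBy G u n (segClass G u n q) r (spanClass G u n r q) := by
  refine ⟨r, q, le_rfl, he, rfl, fun k hk hkq h => ?_, rfl⟩
  rcases hk.eq_or_lt with rfl | hlt
  · exact hne h
  · exact he.not_special k hlt hkq (he.right.of_segClass_eq hu h.symm)

/-! ### Palindromic returns make the graphs of symmetries trees -/

theorem PalindromicReturns.simple (hP : PalindromicReturns G u n) (hu : ClosedUnder G u)
    (hG : ∃ Θ ∈ G, IsAntimorphism Θ.1) : (looplessGraph G u n).Simple where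
  not_isLoopAt E x h := (isLink_looplessGraph_iff.1 h).2 rfl
  eq_of_isLink := by
    intro E E' x y h h'
    rw [isLink_looplessGraph_iff, isLink_symGraph_iff hu hG] at h h'
    obtain ⟨⟨r, q, he, rfl, rfl, rfl⟩, hne⟩ := h
    obtain ⟨⟨r', q', he', rfl, hr, hq⟩, -⟩ := h'
    have h2 := he'.entersBy hu (by rwa [← hr, ← hq])
    rw [← hq] at h2
    exact hP.entersBy_unique hu hG he.left hr.symm (he.entersBy hu hne) h2

theorem preconnected_looplessGraph (hu : ClosedUnder G u) (hG : ∃ Θ ∈ G, IsAntimorphism Θ.1) :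
    (looplessGraph G u n).toSimpleGraph.Preconnected := by
  have key : ∀ (v w) (i j : ℕ), i ≤ j → SpecialAt u n i → SpecialAt u n j →
      v.1 = segClass G u n i → w.1 = segClass G u n j →
      (looplessGraph G u n).toSimpleGraph.Reachable v w := by
    intro v w i j hij hi hj hv hw
    refine reachable_of_forall_edgeAt hij hi hj ?_ hv hw
    intro r q _ _ he v w hv hw hvw
    refine ⟨hvw, spanClass G u n r q, isLink_looplessGraph_iff.2 ⟨?_, fun h => hvw (Subtype.ext h)⟩⟩
    exact (isLink_symGraph_iff hu hG).2 ⟨r, q, he, rfl, hv, hw⟩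
  intro v w
  obtain ⟨i, hi, hv⟩ := exists_of_mem_symVertices v.2
  obtain ⟨j, hj, hw⟩ := exists_of_mem_symVertices w.2
  rcases le_total i j with hij | hij
  · exact key v w i j hij hi hj hv hw
  · exact (key w v j i hij hj hi hw hv).symm

/-- Every edge is a bridge: the vertices `Z ≠ X` from which `X` is entered through a given edge
form a union of components of the graph without this edge. -/
theorem PalindromicReturns.isAcyclic (hP : PalindromicReturns G u n) (hu : ClosedUnder G u)
    (hG : ∃ Θ ∈ G, IsAntimorphism Θ.1) : (looplessGraph G u n).toSimpleGraph.IsAcyclic := by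
  rw [SimpleGraph.isAcyclic_iff_forall_adj_isBridge]
  rintro y x ⟨-, E, hE⟩
  rw [SimpleGraph.isBridge_iff]
  intro hreach
  have hx := x.2
  have hE' := hE
  rw [isLink_looplessGraph_iff, isLink_symGraph_iff hu hG] at hE'
  obtain ⟨⟨r, q, he, rfl, hyr, hxq⟩, hyx⟩ := hE'
  have hy : EntersBy G u n x.1 r (spanClass G u n r q) := by
    rw [hxq]; exact he.entersBy hu (by rwa [← hyr, ← hxq])
  have key : ∀ z, ((looplessGraph G u n).toSimpleGraph.deleteEdges {s(y, x)}).Reachable y z →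
      z.1 ≠ x.1 ∧ ∃ t, SpecialAt u n t ∧ z.1 = segClass G u n t ∧
        EntersBy G u n x.1 t (spanClass G u n r q) := by
    intro z hz
    rw [SimpleGraph.reachable_iff_reflTransGen] at hz
    induction hz with
    | refl => exact ⟨hyx, r, he.left, hyr, hy⟩
    | @tail z z' _ hadj ih =>
      obtain ⟨hzx, t, ht, hzt, htE⟩ := ih
      rw [SimpleGraph.deleteEdges_adj] at hadj
      obtain ⟨⟨-, F, hF⟩, hnot⟩ := hadj
      have hF' := hF
      rw [isLink_looplessGraph_iff, isLink_symGraph_iff hu hG] at hF'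
      obtain ⟨⟨r', q', he', rfl, hzr', hzq'⟩, hzz'⟩ := hF'
      have heq : segClass G u n r' = segClass G u n t := hzr'.symm.trans hzt
      by_cases hz'x : z'.1 = x.1
      · exfalso
        have h1 := he'.entersBy hu (by rwa [← hzr', ← hzq'])
        rw [← hzq', hz'x] at h1
        have h2 := hP.entersBy_unique hu hG ht heq htE h1
        rw [← h2, hz'x] at hF
        have hzy : z = y := by
          rcases hF.eq_and_eq_or_eq_and_eq hE with h | h
          · exact Subtype.ext h.1
          · exact absurd h.1 hzx
        exact hnot (by rw [hzy, Subtype.ext hz'x]; rfl)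
      · refine ⟨hz'x, q', he'.right, hzq', ?_⟩
        obtain ⟨E', hE'⟩ := exists_entersBy hu hG hx he'.right (by rwa [← hzq'])
        have h1 : EntersBy G u n x.1 r' E' := by
          refine hE'.of_le he'.lt.le fun k hk hkq h => ?_
          rcases hk.eq_or_lt with rfl | hlt
          · exact hzx (hzr'.trans h)
          · obtain ⟨i, hi, hxi⟩ := exists_of_mem_symVertices hx
            exact he'.not_special k hlt hkq (hi.of_segClass_eq hu (hxi.symm.trans h.symm))
        rwa [hP.entersBy_unique hu hG ht heq htE h1]
  exact (key x hreach).1 rfl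

theorem PalindromicReturns.isTreeWithoutLoops (hP : PalindromicReturns G u n)
    (hu : ClosedUnder G u) (hG : ∃ Θ ∈ G, IsAntimorphism Θ.1) :
    IsTreeWithoutLoops (symGraph G u n) :=
  ⟨hP.simple hu hG, preconnected_looplessGraph hu hG, hP.isAcyclic hu hG⟩

theorem PalindromicReturns.isGPalindrome_of_isLoopAt (hP : PalindromicReturns G u n)
    (hu : ClosedUnder G u) (hG : ∃ Θ ∈ G, IsAntimorphism Θ.1) {e : List α} {x : Set (List α)}
    (h : (symGraph G u n).IsLoopAt (wordClass G e) x) : IsGPalindrome G e := by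
  obtain ⟨r, q, he, hE, rfl, hq⟩ := (isLink_symGraph_iff hu hG).1 h
  have hlt := he.lt
  have hret : ReturnAt G u n r (q - r) := by
    refine ⟨by omega, by rw [show r + (q - r) = q by omega]; exact hq.symm, fun k hk hkd h => ?_⟩
    exact he.not_special (r + k) (by omega) (by omega) (he.left.of_segClass_eq hu h.symm)
  obtain ⟨g, rfl⟩ := wordClass_eq_iff.1 hE.symm
  exact (hP _ _ hret).smul g

/-! ### Returns to special factors in a tree -/

/-- In a tree, a walk that leaves `X` and comes back without visiting `X` in between does so
through one edge. Hence a complete `G`-return word to a special factor, if it is not itself a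
loop, begins with an edge and ends with an image of this edge; the image is antimorphic, as the
edge is traversed in the opposite direction. -/
theorem ReturnAt.exists_isAntimorphism_of_specialAt (hu : ClosedUnder G u)
    (hG : ∃ Θ ∈ G, IsAntimorphism Θ.1) (hT : IsTreeWithoutLoops (symGraph G u n)) {i d : ℕ}
    (hret : ReturnAt G u n i d) (hi : SpecialAt u n i) :
    EdgeAt u n i (i + d) ∨ ∃ a, 0 < a ∧ a ≤ d ∧ ∃ g : G, IsAntimorphism g.1.1 ∧
      g • seg u i (n + a) = seg u (i + d - a) (n + a) := by
  have hd := hret.pos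
  have hid : SpecialAt u n (i + d) := hi.of_segClass_eq hu hret.eq.symm
  obtain ⟨s, hs, hes⟩ := hi.exists_edgeAt_right hid (by omega)
  rcases hs.eq_or_lt with rfl | hs
  · exact Or.inl hes
  right
  obtain ⟨r, hr, her⟩ := hes.right.exists_edgeAt_left hid hs
  have his := hes.lt
  have hrd := her.lt
  have hne : ∀ k, i < k → k < i + d → segClass G u n k ≠ segClass G u n i := fun k hk hkd => by
    have := hret.ne (k - i) (by omega) (by omega)
    rwa [show i + (k - i) = k by omega] at this
  have hlink : ∀ p q, EdgeAt u n p q → segClass G u n p ≠ segClass G u n q →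
      (looplessGraph G u n).IsLink (spanClass G u n p q) (segClass G u n p) (segClass G u n q) :=
    fun p q he hpq =>
      isLink_looplessGraph_iff.2 ⟨(isLink_symGraph_iff hu hG).2 ⟨p, q, he, rfl, rfl, rfl⟩, hpq⟩
  have hl1 := hlink i s hes (hne s his hs).symm
  have hl2 := hlink r (i + d) her (by rw [hret.eq]; exact hne r (by omega) hrd)
  rw [hret.eq] at hl2
  have hsr : segClass G u n s = segClass G u n r := by
    by_contra hsr
    let x : (looplessGraph G u n).vertexSet := ⟨_, hi.mem_vertexSet⟩
    let y : (looplessGraph G u n).vertexSet := ⟨_, hes.right.mem_vertexSet⟩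
    let y' : (looplessGraph G u n).vertexSet := ⟨_, her.left.mem_vertexSet⟩
    have hyx : y ≠ x := fun h => hne s his hs (congrArg Subtype.val h)
    have hy'x : y' ≠ x := fun h => hne r (by omega) hrd (congrArg Subtype.val h)
    have hyy' : y ≠ y' := fun h => hsr (congrArg Subtype.val h)
    refine SimpleGraph.isBridge_iff.1 (SimpleGraph.isAcyclic_iff_forall_adj_isBridge.1 hT.2.2
      (v := y) (w := x) ⟨hyx, _, hl1.symm⟩) (SimpleGraph.Reachable.trans (v := y') ?_ ?_)
    · refine reachable_of_forall_edgeAt hr hes.right her.left ?_ rfl rfl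
      intro p q hp hq he v w hv hw hvw
      have hpq := he.lt
      rw [SimpleGraph.deleteEdges_adj]
      refine ⟨⟨hvw, _, hv ▸ hw ▸ hlink p q he fun h => hvw (Subtype.ext (by rw [hv, hw, h]))⟩, ?_⟩
      have hvx : v ≠ x := fun h => hne p (by omega) (by omega) (hv ▸ congrArg Subtype.val h)
      have hwx : w ≠ x := fun h => hne q (by omega) (by omega) (hw ▸ congrArg Subtype.val h)
      rw [Set.mem_singleton_iff, Sym2.eq_iff]
      rintro (h | h)
      · exact hwx h.2
      · exact hvx h.1
    · refine SimpleGraph.Adj.reachable ?_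
      rw [SimpleGraph.deleteEdges_adj]
      refine ⟨⟨hy'x, _, hl2⟩, ?_⟩
      rw [Set.mem_singleton_iff, Sym2.eq_iff]
      rintro (h | h)
      · exact hyy' h.1.symm
      · exact hy'x h.1
  rw [← hsr] at hl2
  obtain ⟨g, hg⟩ := wordClass_eq_iff.1 (hT.1.eq_of_isLink hl1 hl2.symm)
  have hlen : s - i + n = i + d - r + n := by
    simpa [length_smul] using congrArg List.length hg
  refine ⟨s - i, by omega, by omega, g, ?_, ?_⟩
  · refine (isMorphism_or_isAntimorphism g).resolve_left fun hm => ?_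
    rw [← hlen] at hg
    have := smul_seg_of_isMorphism hm hg (a := 0) (m := n) (by omega)
    exact hne r (by omega) hrd (segClass_eq_iff.2 ⟨g, this⟩).symm
  · rw [← hlen] at hg
    rw [Nat.add_comm n, hg]
    congr 1
    omega

theorem seg_two_sided_eq_of_not_specialAt {i j : ℕ} (h : ¬ SpecialAt u n (i + 1))
    (hij : seg u (i + 1) n = seg u (j + 1) n) : seg u i (n + 2) = seg u j (n + 2) := by
  have h1 := seg_pred_eq_of_not_specialAt h hij
  have h2 := seg_succ_eq_of_not_specialAt h hij
  rw [seg_succ', seg_succ'] at h1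
  rw [seg_succ' u i, seg_succ' u j, h2, (List.cons.inj h1).1]

theorem exists_isAntimorphism_smul_seg_succ (hu : ClosedUnder G u) {i d : ℕ} (hd : 0 < d)
    (hi : ¬ SpecialAt u n i) {g : G} (hg : IsAntimorphism g.1.1)
    (h : g • seg u i n = seg u (i + d) n) : g • seg u i (n + 1) = seg u (i + d - 1) (n + 1) := by
  obtain ⟨j, hj⟩ := hu.exists_smul_seg g i (n + 1)
  have h1 := smul_seg_of_isAntimorphism hg hj (a := 0) (m := n) (b := 1) (by omega)
  rw [Nat.add_zero, h, show i + d = i + d - 1 + 1 by omega] at h1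
  rw [hj, seg_pred_eq_of_not_specialAt _ h1]
  rw [show i + d - 1 + 1 = i + d by omega]
  exact fun hs => hi (hs.of_segClass_eq hu (segClass_eq_iff.2 ⟨g, h⟩).symm)

/-- A complete `G`-return word to a factor `w` is also one to any longer prefix whose antimorphic
image is a suffix. -/
theorem ReturnAt.extend {i d a : ℕ} (hret : ReturnAt G u n i d) (ha : a < d) {g : G}
    (h : g • seg u i (n + a) = seg u (i + d - a) (n + a)) : ReturnAt G u (n + a) i (d - a) := by
  refine ⟨by omega, ?_, fun k hk hkd hcl => ?_⟩
  · rw [show i + (d - a) = i + d - a by omega]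
    exact (segClass_eq_iff.2 ⟨g, h⟩).symm
  · obtain ⟨f, hf⟩ := segClass_eq_iff.1 hcl.symm
    rcases isMorphism_or_isAntimorphism f with hm | hm
    · exact hret.ne k hk (by omega)
        (segClass_eq_iff.2 ⟨f, smul_seg_of_isMorphism hm hf (a := 0) (by omega)⟩).symm
    · have := smul_seg_of_isAntimorphism hm hf (a := 0) (m := n) (b := a) (by omega)
      rw [Nat.add_assoc] at this
      exact hret.ne (k + a) (by omega) (by omega) (segClass_eq_iff.2 ⟨f, this⟩).symm

theorem ReturnAt.congr {i j d : ℕ} (hret : ReturnAt G u n i d)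
    (h : seg u i (d + n) = seg u j (d + n)) : ReturnAt G u n j d := by
  have key : ∀ k, k ≤ d → segClass G u n (j + k) = segClass G u n (i + k) := fun k hk => by
    rw [segClass, segClass, seg_eq_seg_of_add h (by omega)]
  have h0 : segClass G u n j = segClass G u n i := key 0 (by omega)
  refine ⟨hret.pos, ?_, fun k hk hkd => ?_⟩
  · rw [key d le_rfl, h0, hret.eq]
  · rw [key k hkd.le, h0]
    exact hret.ne k hk hkd

/-! ### Trees of symmetries make the returns palindromic -/

/-- All returns of shift less than `d` to factors of length at least `N` are palindromic. -/
def PalindromicBelow (G : Subgroup (AM α)) (u : ℕ → α) (N d : ℕ) : Prop :=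
  ∀ d', d' < d → ∀ n, N ≤ n → ∀ i, ReturnAt G u n i d' → IsGPalindrome G (seg u i (d' + n))

/-- A counterexample of shift `d`: a return to a factor of length `n ≥ N` which is not a
`G`-palindrome. -/
structure BadReturn (G : Subgroup (AM α)) (u : ℕ → α) (N d n i : ℕ) : Prop where
  le : N ≤ n
  returnAt : ReturnAt G u n i d
  not_palindrome : ¬ IsGPalindrome G (seg u i (d + n))

theorem BadReturn.congr {d i j : ℕ} (h : BadReturn G u N d n i)
    (hij : seg u i (d + n) = seg u j (d + n)) : BadReturn G u N d n j :=
  ⟨h.le, h.returnAt.congr hij, hij ▸ h.not_palindrome⟩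

theorem BadReturn.not_smul_eq {d i : ℕ} (h : BadReturn G u N d n i)
    (hbelow : PalindromicBelow G u N d) {a : ℕ} (ha : 0 < a) (had : a ≤ d) {g : G}
    (hg : IsAntimorphism g.1.1) : g • seg u i (n + a) ≠ seg u (i + d - a) (n + a) := by
  intro hga
  refine h.not_palindrome ?_
  rcases had.eq_or_lt with rfl | hlt
  · rw [show i + a - a = i by omega] at hga
    rw [Nat.add_comm]
    exact isGPalindrome_iff.2 ⟨g, hg, hga⟩
  · have := hbelow (d - a) (by omega) (n + a) (by have := h.le; omega) i
      (h.returnAt.extend hlt hga)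
    rwa [show d - a + (n + a) = d + n by omega] at this

theorem BadReturn.not_specialAt {d i : ℕ} (h : BadReturn G u N d n i)
    (hbelow : PalindromicBelow G u N d) (hu : ClosedUnder G u)
    (hG : ∃ Θ ∈ G, IsAntimorphism Θ.1) (htls : PropertyTls G N u) : ¬ SpecialAt u n i := by
  intro hi
  obtain ⟨-, hloop, hT⟩ := htls n h.le
  rcases h.returnAt.exists_isAntimorphism_of_specialAt hu hG hT hi with he | ⟨a, ha, had, g, hg, hga⟩
  · have hE : (symGraph G u n).IsLoopAt (spanClass G u n i (i + d)) (segClass G u n i) :=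
      (isLink_symGraph_iff hu hG).2 ⟨i, i + d, he, rfl, rfl, h.returnAt.eq.symm⟩
    have := hloop _ _ hE
    rw [Nat.add_sub_cancel_left] at this
    exact h.not_palindrome this
  · exact h.not_smul_eq hbelow ha had hg hga

theorem BadReturn.isMorphism {d i : ℕ} (h : BadReturn G u N d n i)
    (hbelow : PalindromicBelow G u N d) (hu : ClosedUnder G u)
    (hi : ¬ SpecialAt u n i) {g : G} (hg : g • seg u i n = seg u (i + d) n) :
    IsMorphism g.1.1 := by
  refine (isMorphism_or_isAntimorphism g).resolve_right fun hanti => ?_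
  have hd := h.returnAt.pos
  exact h.not_smul_eq hbelow Nat.one_pos hd hanti
    (exists_isAntimorphism_smul_seg_succ hu hd hi hanti hg)

theorem BadReturn.exists_smul {d i : ℕ} (h : BadReturn G u N d n i) :
    ∃ g : G, g • seg u i n = seg u (i + d) n := segClass_eq_iff.1 h.returnAt.eq.symm

/-- The factor of a counterexample has unique extensions by a letter on both sides, and these
extensions give a counterexample of the same shift. -/
theorem BadReturn.extend {d i : ℕ} (h : BadReturn G u N d n (i + 1))
    (hbelow : PalindromicBelow G u N d) (hu : ClosedUnder G u)
    (hi : ¬ SpecialAt u n (i + 1)) : BadReturn G u N d (n + 2) i := by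
  obtain ⟨g, hg⟩ := h.exists_smul
  have hm := h.isMorphism hbelow hu hi hg
  obtain ⟨j, hj⟩ := hu.exists_smul_seg g i (n + 2)
  have h1 := smul_seg_of_isMorphism hm hj (a := 1) (m := n) (by omega)
  rw [hg, show i + 1 + d = i + d + 1 by omega] at h1
  have h2 := seg_two_sided_eq_of_not_specialAt (fun hs => hi (hs.of_segClass_eq hu (by
    rw [show i + d + 1 = i + 1 + d by omega]; exact h.returnAt.eq))) h1
  refine ⟨by have := h.le; omega, ⟨h.returnAt.pos, ?_, fun k hk hkd hcl => ?_⟩, fun hpal => ?_⟩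
  · exact (segClass_eq_iff.2 ⟨g, hj.trans h2.symm⟩).symm
  · obtain ⟨f, hf⟩ := segClass_eq_iff.1 hcl.symm
    refine h.returnAt.ne k hk hkd (segClass_eq_iff.2 ⟨f, ?_⟩).symm
    rw [show i + 1 + k = i + k + 1 by omega]
    rcases isMorphism_or_isAntimorphism f with hf' | hf'
    · exact smul_seg_of_isMorphism hf' hf (by omega)
    · exact smul_seg_of_isAntimorphism hf' hf (by omega)
  · obtain ⟨f, hf', hf⟩ := isGPalindrome_iff.1 hpal
    exact h.not_palindrome (isGPalindrome_iff.2
      ⟨f, hf', smul_seg_of_isAntimorphism hf' hf (by omega)⟩)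

/-- The factor of a counterexample determines everything that follows it, because it can be
extended uniquely again and again. -/
theorem BadReturn.seg_eq {d i : ℕ} (h : BadReturn G u N d n i)
    (hbelow : PalindromicBelow G u N d) (hu : ClosedUnder G u)
    (hG : ∃ Θ ∈ G, IsAntimorphism Θ.1) (htls : PropertyTls G N u) (k : ℕ) {j : ℕ}
    (hj : seg u j n = seg u i n) : seg u j (n + k) = seg u i (n + k) := by
  induction k generalizing n i j with
  | zero => exact hj
  | succ k ih =>
    -- by recurrence, both occurrences may be assumed to have a letter to their left
    obtain ⟨i', hi', hi⟩ := hu.exists_le_seg_eq hG i (d + n + k + 1) 1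
    obtain ⟨j', hj', hjj⟩ := hu.exists_le_seg_eq hG j (n + (k + 1)) 1
    obtain ⟨p, rfl⟩ := Nat.exists_eq_add_of_le' hi'
    obtain ⟨q, rfl⟩ := Nat.exists_eq_add_of_le' hj'
    have hbad : BadReturn G u N d n (p + 1) := h.congr (seg_eq_seg_of_le hi.symm (by omega))
    have hp := hbad.not_specialAt hbelow hu hG htls
    have hpq : seg u (p + 1) n = seg u (q + 1) n := by
      rw [seg_eq_seg_of_le hi (by omega), seg_eq_seg_of_le hjj (by omega), hj]
    have := ih (hbad.extend hbelow hu hp) (seg_two_sided_eq_of_not_specialAt hp hpq).symm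
    rw [← hjj, ← seg_eq_seg_of_le hi (by omega)]
    exact seg_eq_seg_of_add this (by omega)

/-- After an occurrence of `w` which starts a counterexample, the members of `[w]` occur
periodically, and all of them are morphic images of `w`; so none of them is an antimorphic one. -/
theorem BadReturn.false {d i : ℕ} (h : BadReturn G u N d n i)
    (hbelow : PalindromicBelow G u N d) (hu : ClosedUnder G u)
    (hG : ∃ Θ ∈ G, IsAntimorphism Θ.1) (htls : PropertyTls G N u) : False := by
  have hi := h.not_specialAt hbelow hu hG htls
  obtain ⟨μ, hμ⟩ := h.exists_smul
  have hμm := h.isMorphism hbelow hu hi hμ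
  have hd := h.returnAt.pos
  obtain ⟨θ, hθ⟩ : ∃ g : G, IsAntimorphism g.1.1 := by
    obtain ⟨Θ, hΘ, hanti⟩ := hG
    exact ⟨⟨Θ, hΘ⟩, hanti⟩
  obtain ⟨j₀, hj₀⟩ := hu.exists_smul_seg θ i n
  obtain ⟨j, hij, hj⟩ := hu.exists_le_seg_eq hG j₀ n i
  rw [← hj] at hj₀
  have key : ∀ m p, j - p = m → p ≤ j → ∀ f : G, IsMorphism f.1.1 →
      f • seg u i n = seg u p n → False := by
    intro m
    induction m using Nat.strong_induction_on with
    | _ m ih =>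
      intro p hm hpj f hf hfp
      have hlong : f • seg u i (n + d) = seg u p (n + d) := by
        obtain ⟨q, hq⟩ := hu.exists_smul_seg f⁻¹ p (n + d)
        have h1 := smul_seg_of_isMorphism hf.inv hq (a := 0) (m := n) (by omega)
        rw [Nat.add_zero, Nat.add_zero, ← hfp, inv_smul_smul] at h1
        rw [← h.seg_eq hbelow hu hG htls d h1.symm, ← hq, smul_inv_smul]
      rcases hpj.eq_or_lt with rfl | hlt
      · -- `w` is then fixed by an antimorphism, so its next image is antimorphic as well
        refine h.not_smul_eq hbelow Nat.one_pos hd (g := μ * (f⁻¹ * θ))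
          (hμm.mul_isAntimorphism (hf.inv.mul_isAntimorphism hθ)) ?_
        refine exists_isAntimorphism_smul_seg_succ hu hd hi
          (hμm.mul_isAntimorphism (hf.inv.mul_isAntimorphism hθ)) ?_
        rw [mul_smul, mul_smul, hj₀, ← hfp, inv_smul_smul, hμ]
      rcases le_or_gt (p + d) j with hle | hgt
      · refine ih (j - (p + d)) (by omega) (p + d) rfl hle (f * μ) (hf.mul hμm) ?_
        rw [mul_smul, hμ]
        exact smul_seg_of_isMorphism hf hlong (by omega)
      · have h1 := smul_seg_of_isMorphism hf hlong (a := j - p) (m := n) (by omega)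
        rw [show p + (j - p) = j by omega] at h1
        refine h.returnAt.ne (j - p) (by omega) (by omega) ?_
        exact (segClass_eq_iff.2 ⟨f, h1⟩).trans (segClass_eq_iff.2 ⟨θ, hj₀⟩).symm
  exact key _ i rfl hij 1 (fun _ _ => rfl) (one_smul _ _)

theorem PropertyTls.propertyCrw (hu : ClosedUnder G u) (hG : ∃ Θ ∈ G, IsAntimorphism Θ.1)
    (htls : PropertyTls G N u) : PropertyCrw G N u := by
  rw [propertyCrw_iff]
  suffices H : ∀ d, PalindromicBelow G u N d from
    fun n hn i d hret => H (d + 1) d (Nat.lt_succ_self d) n hn i hret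
  intro d
  induction d with
  | zero => exact fun d' hd' => absurd hd' (Nat.not_lt_zero d')
  | succ d ih =>
    intro d' hd' n hn i hret
    rcases (Nat.lt_succ_iff.1 hd').eq_or_lt with rfl | hlt
    · by_contra hpal
      exact BadReturn.false ⟨hn, hret, hpal⟩ ih hu hG htls
    · exact ih d' hlt n hn i hret

theorem PropertyCrw.propertyTls (hu : ClosedUnder G u) (hG : ∃ Θ ∈ G, IsAntimorphism Θ.1)
    (hcrw : PropertyCrw G N u) : PropertyTls G N u := by
  intro n hn
  have hP : PalindromicReturns G u n := propertyCrw_iff.1 hcrw n hn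
  exact ⟨hu, fun e x h => hP.isGPalindrome_of_isLoopAt hu hG h, hP.isTreeWithoutLoops hu hG⟩

theorem propertyTls_iff_propertyCrw (hu : ClosedUnder G u) (hG : ∃ Θ ∈ G, IsAntimorphism Θ.1)
    (N : ℕ) : PropertyTls G N u ↔ PropertyCrw G N u :=
  ⟨PropertyTls.propertyCrw hu hG, PropertyCrw.propertyTls hu hG⟩

end GRichness

theorem mainTheorem1 {α : Type*} [Finite α] (G : Subgroup (GRichness.AM α)) [Finite G]
    (hG : ∃ Θ ∈ G, GRichness.IsAntimorphism Θ.1)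
    (u : ℕ → α) (hu : GRichness.ClosedUnder G u) :
    (GRichness.IsGRich G u ↔ GRichness.PropertyCrw G 1 u) ∧
    (GRichness.IsAlmostGRich G u ↔ ∃ N : ℕ, GRichness.PropertyCrw G N u) ∧
    (∀ N : ℕ, GRichness.PropertyTls G N u ↔ GRichness.PropertyCrw G N u) := by
  have key := GRichness.propertyTls_iff_propertyCrw hu hG
  exact ⟨key 1, exists_congr key, key⟩
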